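/- Let $H$ be a complex Hilbert space, let $A$ be a bounded linear operator on $H$, let $T$ be a Hilbert–Schmidt operator on $H$ (that is, $T$ is bounded and $\sum_i \|Te_i\|^2<\infty$ for some orthonormal basis $(e_i)$ of $H$), and let $N\ge 1$ be an integer. Then $A T^{2N}$ and $(T^*T)^N$ are trace-class, so that their traces $\operatorname{Tr} X=\sum_i\langle e_i, X e_i\rangle$ converge in every orthonormal basis $(e_i)$ and do not depend on it, the number $\operatorname{Tr}\big((T^*T)^N\big)$ is real, and $$\left|\operatorname{Tr}\big(A\,T^{2N}\big)\right|\le \|A\|\,\operatorname{Tr}\big((T^*T)^N\big).$$ -/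

import Mathlib

open scoped InnerProductSpace

universe u

noncomputable section

namespace TraceIneq

variable {H : Type u} [NormedAddCommGroup H] [InnerProductSpace ℂ H] [CompleteSpace H]

/-- A bounded operator `T` on a complex Hilbert space is Hilbert-Schmidt if
`∑ i, ‖T (e i)‖ ^ 2` converges for some orthonormal basis `e` of the space. -/
def IsHilbertSchmidt (T : H →L[ℂ] H) : Prop :=
  ∃ (w : Set H) (e : HilbertBasis w ℂ H), Summable fun i => ‖T (e i)‖ ^ 2

/-- A bounded operator `X` on a complex Hilbert space is trace-class if
`∑ i, ⟪e i, |X| (e i)⟫` converges for some orthonormal basis `e` of the space,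
where `|X|` is the positive square root of `X* X`. -/
def IsTraceClass (X : H →L[ℂ] H) : Prop :=
  ∃ (w : Set H) (e : HilbertBasis w ℂ H), Summable fun i => ⟪e i, CFC.abs X (e i)⟫_ℂ

variable (H) in
/-- The index set of a chosen orthonormal basis of `H`. -/
def basisSet : Set H := (exists_hilbertBasis ℂ H).choose

variable (H) in
/-- A chosen orthonormal basis of `H`. -/
def basis : HilbertBasis (basisSet H) ℂ H := (exists_hilbertBasis ℂ H).choose_spec.choose

/-- The trace `∑ i, ⟪e i, X (e i)⟫` of an operator, computed in the chosen orthonormal basis. -/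
def trace (X : H →L[ℂ] H) : ℂ := ∑' i, ⟪basis H i, X (basis H i)⟫_ℂ

/-- The trace of `X` is well defined: `X` is trace-class, and in every orthonormal basis `e`
the family `⟪e i, X (e i)⟫` is (unconditionally, hence absolutely) summable with the same
sum `trace X`. -/
def HasWellDefinedTrace (X : H →L[ℂ] H) : Prop :=
  IsTraceClass X ∧
    ∀ (ι : Type u) (e : HilbertBasis ι ℂ H), HasSum (fun i => ⟪e i, X (e i)⟫_ℂ) (trace X)

end TraceIneq

end

namespace TraceIneq

/-! ### Regularised polar decomposition. -/

section CStarAlgebra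

variable {A : Type*} [CStarAlgebra A] [PartialOrder A] [StarOrderedRing A]

/-! Cauchy–Schwarz for the Hilbert–Schmidt product, applied to `A T^N` and `T^N`, bounds the left
side by `‖A‖ Tr(T*^N T^N)`. It remains to compare words of length `2N` in `T` and `T*`. There are
finitely many, so some word has maximal `|Tr|`. If it splits into halves `K L`, then `|Tr KL|² ≤
Tr(K*K) Tr(L*L)` makes `K*K` maximal too (`IsMaxWord.flip_append`). If `K = UV` with `U`
alternating, a cyclic rotation turns `V*U*UV` into `U*UVV*`, whose prefix `U*U` alternates and is
twice as long (`exists_isChain_take`). Iterating yields an alternating maximal word, whose trace is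
`Tr((T*T)^N)`. -/

theorem exists_norm_abs_sub_star_mul_le (X : A) {ε : ℝ} (hε : 0 < ε) :
    ∃ V : A, ‖V‖ ≤ 1 ∧ ‖CFC.abs X - star V * X‖ ≤ ε := by
  set P := CFC.abs X with hP
  have hP0 : 0 ≤ P := CFC.abs_nonneg X
  have hsa : IsSelfAdjoint P := .of_nonneg hP0
  have hPP : star X * X = P * P := (CFC.abs_mul_abs X).symm
  have hspec : ∀ x ∈ spectrum ℝ P, 0 ≤ x := fun x hx => spectrum_nonneg_of_nonneg hP0 hx
  have hpos : ∀ x ∈ spectrum ℝ P, 0 < x + ε := fun x hx => by linarith [hspec x hx]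
  have hc : ContinuousOn (fun x : ℝ => (x + ε)⁻¹) (spectrum ℝ P) :=
    (by fun_prop : ContinuousOn (fun x : ℝ => x + ε) _).inv₀ fun x hx => (hpos x hx).ne'
  have hc2 : ContinuousOn (fun x : ℝ => (x + ε)⁻¹ * (x * x)) (spectrum ℝ P) :=
    hc.mul (by fun_prop)
  have hid : cfc (fun x : ℝ => x) P = P := cfc_id' ℝ P
  set h := cfc (fun x : ℝ => (x + ε)⁻¹) P with hh
  have hstar : star h = h := (cfc_predicate (fun x : ℝ => (x + ε)⁻¹) P : IsSelfAdjoint h)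
  have h1 : h * (P * P) = cfc (fun x : ℝ => (x + ε)⁻¹ * (x * x)) P := by
    rw [cfc_mul (fun x : ℝ => (x + ε)⁻¹) (fun x => x * x) P hc (by fun_prop),
      cfc_mul (fun x : ℝ => x) (fun x => x) P (by fun_prop) (by fun_prop), hid]
  -- With `V = X(P + ε)⁻¹`, `V*V = P²(P + ε)⁻²` and `P - V*X = εP(P + ε)⁻¹`; both bounds are scalar
  -- inequalities on the nonnegative spectrum of `P`.
  refine ⟨X * h, ?_, ?_⟩
  · have h2 : star (X * h) * (X * h) = cfc (fun x : ℝ => (x + ε)⁻¹ * (x * x) * (x + ε)⁻¹) P := by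
      rw [star_mul, hstar, mul_assoc, ← mul_assoc (star X), hPP, ← mul_assoc, h1, hh,
        ← cfc_mul (fun x : ℝ => (x + ε)⁻¹ * (x * x)) (fun x => (x + ε)⁻¹) P hc2 hc]
    have h3 : ‖star (X * h) * (X * h)‖ ≤ 1 := by
      rw [h2]
      refine norm_cfc_le zero_le_one fun x hx => ?_
      have := hspec x hx
      have := hpos x hx
      rw [Real.norm_of_nonneg (by positivity)]
      field_simp
      nlinarith
    rw [CStarRing.norm_star_mul_self] at h3
    nlinarith [norm_nonneg (X * h)]
  · have h2 : P - star (X * h) * X = cfc (fun x : ℝ => x - (x + ε)⁻¹ * (x * x)) P := by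
      rw [star_mul, hstar, mul_assoc, hPP, h1, cfc_sub (fun x : ℝ => x) _ P (by fun_prop) hc2, hid]
    rw [h2]
    refine norm_cfc_le hε.le fun x hx => ?_
    have := hspec x hx
    have := hpos x hx
    have h4 : x - (x + ε)⁻¹ * (x * x) = x * ε / (x + ε) := by field_simp; ring
    rw [h4, Real.norm_of_nonneg (by positivity), div_le_iff₀ this]
    nlinarith

end CStarAlgebra

/-! ### Hilbert–Schmidt operators and traces of their products. -/

open ContinuousLinearMap

variable {H : Type u} [NormedAddCommGroup H] [InnerProductSpace ℂ H] [CompleteSpace H]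
  {ι κ : Type*}

omit [CompleteSpace H] in
theorem hasSum_norm_sq_inner (e : HilbertBasis ι ℂ H) (x : H) :
    HasSum (fun i => ‖⟪e i, x⟫_ℂ‖ ^ 2) (‖x‖ ^ 2) := by
  have h := Complex.reCLM.hasSum (e.hasSum_inner_mul_inner x x)
  rw [inner_self_eq_norm_sq_to_K] at h
  convert h using 1
  · ext i
    rw [← inner_conj_symm x (e i), ← Complex.normSq_eq_conj_mul_self,
      ← Complex.normSq_eq_norm_sq, Complex.reCLM_apply, Complex.ofReal_re]
  · simp [← Complex.ofReal_pow]

omit [CompleteSpace H] in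
theorem summable_norm_sq_inner_prod (e : HilbertBasis ι ℂ H) (f : HilbertBasis κ ℂ H)
    {T : H →L[ℂ] H} (hT : Summable fun i => ‖T (e i)‖ ^ 2) :
    Summable fun p : ι × κ => ‖⟪f p.2, T (e p.1)⟫_ℂ‖ ^ 2 := by
  have h0 : ∀ p : ι × κ, 0 ≤ ‖⟪f p.2, T (e p.1)⟫_ℂ‖ ^ 2 := fun p => sq_nonneg _
  have h1 : ∀ i, HasSum (fun j => ‖⟪f j, T (e i)⟫_ℂ‖ ^ 2) (‖T (e i)‖ ^ 2) := fun i =>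
    hasSum_norm_sq_inner f (T (e i))
  exact (summable_prod_of_nonneg h0).2
    ⟨fun i => (h1 i).summable, hT.congr fun i => (h1 i).tsum_eq.symm⟩

/-- By Parseval both sums are the double sum of `|⟪f j, T (e i)⟫|²`, taken in either order. -/
theorem hasSum_norm_sq_adjoint (e : HilbertBasis ι ℂ H) (f : HilbertBasis κ ℂ H)
    {T : H →L[ℂ] H} (hT : Summable fun i => ‖T (e i)‖ ^ 2) :
    HasSum (fun j => ‖adjoint T (f j)‖ ^ 2) (∑' i, ‖T (e i)‖ ^ 2) := by
  have h := summable_norm_sq_inner_prod e f hT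
  have h1 := h.hasSum.prod_fiberwise fun i => hasSum_norm_sq_inner f (T (e i))
  rw [h1.tsum_eq]
  refine (((Equiv.prodComm κ ι).hasSum_iff.2 h.hasSum).prod_fiberwise fun j => ?_)
  convert hasSum_norm_sq_inner e (adjoint T (f j)) using 2 with i
  rw [adjoint_inner_right, norm_inner_symm]
  rfl

theorem hasSum_norm_sq (e : HilbertBasis ι ℂ H) (f : HilbertBasis κ ℂ H)
    {T : H →L[ℂ] H} (hT : Summable fun i => ‖T (e i)‖ ^ 2) :
    HasSum (fun j => ‖T (f j)‖ ^ 2) (∑' i, ‖T (e i)‖ ^ 2) := by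
  have h := hasSum_norm_sq_adjoint e e hT
  have h1 := hasSum_norm_sq_adjoint e f h.summable
  rwa [adjoint_adjoint, h.tsum_eq] at h1

/-- The squared Hilbert-Schmidt norm. -/
noncomputable def hsNormSq (T : H →L[ℂ] H) : ℝ := ∑' i, ‖T (basis H i)‖ ^ 2

theorem hsNormSq_nonneg (T : H →L[ℂ] H) : 0 ≤ hsNormSq T := tsum_nonneg fun _ => by positivity

namespace IsHilbertSchmidt

variable {S T : H →L[ℂ] H}

theorem hasSum (hT : IsHilbertSchmidt T) (e : HilbertBasis ι ℂ H) :
    HasSum (fun i => ‖T (e i)‖ ^ 2) (hsNormSq T) := by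
  obtain ⟨w, f, hf⟩ := hT
  exact hasSum_norm_sq (basis H) e (hasSum_norm_sq f (basis H) hf).summable

protected theorem adjoint (hT : IsHilbertSchmidt T) : IsHilbertSchmidt (adjoint T) :=
  ⟨_, basis H, (hasSum_norm_sq_adjoint (basis H) (basis H) (hT.hasSum _).summable).summable⟩

theorem hsNormSq_adjoint (hT : IsHilbertSchmidt T) : hsNormSq (adjoint T) = hsNormSq T :=
  (hasSum_norm_sq_adjoint (basis H) (basis H) (hT.hasSum _).summable).tsum_eq

omit [CompleteSpace H] in
theorem norm_sq_mul_apply_le (A T : H →L[ℂ] H) (x : H) :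
    ‖(A * T) x‖ ^ 2 ≤ ‖A‖ ^ 2 * ‖T x‖ ^ 2 := by
  rw [← mul_pow]
  exact pow_le_pow_left₀ (norm_nonneg _) (A.le_opNorm _) 2

theorem mul_left (hT : IsHilbertSchmidt T) (A : H →L[ℂ] H) : IsHilbertSchmidt (A * T) :=
  ⟨_, basis H, Summable.of_nonneg_of_le (fun _ => by positivity)
    (fun _ => norm_sq_mul_apply_le A T _) ((hT.hasSum (basis H)).summable.mul_left _)⟩

theorem hsNormSq_mul_le (hT : IsHilbertSchmidt T) (A : H →L[ℂ] H) :
    hsNormSq (A * T) ≤ ‖A‖ ^ 2 * hsNormSq T :=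
  hasSum_le (fun _ => norm_sq_mul_apply_le A T _) ((hT.mul_left A).hasSum (basis H))
    ((hT.hasSum (basis H)).mul_left _)

theorem mul_right (hT : IsHilbertSchmidt T) (A : H →L[ℂ] H) : IsHilbertSchmidt (T * A) := by
  have h := (hT.adjoint.mul_left (adjoint A)).adjoint
  rwa [← star_eq_adjoint, ← star_eq_adjoint, ← star_eq_adjoint, ← star_mul, star_star] at h

theorem summable_inner_mul_inner (hS : IsHilbertSchmidt S) (hT : IsHilbertSchmidt T)
    (e : HilbertBasis ι ℂ H) (f : HilbertBasis κ ℂ H) :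
    Summable fun p : ι × κ => ⟪e p.1, S (f p.2)⟫_ℂ * ⟪f p.2, T (e p.1)⟫_ℂ := by
  have h1 := summable_norm_sq_inner_prod e f (hS.adjoint.hasSum e).summable
  have h2 := summable_norm_sq_inner_prod e f (hT.hasSum e).summable
  refine Summable.of_norm_bounded (h1.add h2) fun p => ?_
  rw [adjoint_inner_right, norm_mul, norm_inner_symm (e p.1)]
  nlinarith [sq_nonneg (‖⟪S (f p.2), e p.1⟫_ℂ‖ - ‖⟪f p.2, T (e p.1)⟫_ℂ‖),
    sq_nonneg (‖⟪S (f p.2), e p.1⟫_ℂ‖), sq_nonneg (‖⟪f p.2, T (e p.1)⟫_ℂ‖)]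

theorem hasSum_inner_mul (hS : IsHilbertSchmidt S) (hT : IsHilbertSchmidt T)
    (e : HilbertBasis ι ℂ H) (f : HilbertBasis κ ℂ H) :
    HasSum (fun i => ⟪e i, (S * T) (e i)⟫_ℂ)
      (∑' p : ι × κ, ⟪e p.1, S (f p.2)⟫_ℂ * ⟪f p.2, T (e p.1)⟫_ℂ) := by
  refine (hS.summable_inner_mul_inner hT e f).hasSum.prod_fiberwise fun i => ?_
  have h := f.hasSum_inner_mul_inner (adjoint S (e i)) (T (e i))
  simp only [adjoint_inner_left] at h
  exact h

omit [CompleteSpace H] in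
theorem tsum_prod_comm (S T : H →L[ℂ] H) (e : HilbertBasis ι ℂ H) (f : HilbertBasis κ ℂ H) :
    (∑' p : κ × ι, ⟪f p.1, T (e p.2)⟫_ℂ * ⟪e p.2, S (f p.1)⟫_ℂ) =
      ∑' p : ι × κ, ⟪e p.1, S (f p.2)⟫_ℂ * ⟪f p.2, T (e p.1)⟫_ℂ := by
  rw [← (Equiv.prodComm κ ι).tsum_eq]
  exact tsum_congr fun p => mul_comm _ _

theorem trace_mul_comm (hS : IsHilbertSchmidt S) (hT : IsHilbertSchmidt T) :
    trace (S * T) = trace (T * S) := by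
  rw [trace, trace, (hS.hasSum_inner_mul hT (basis H) (basis H)).tsum_eq,
    (hT.hasSum_inner_mul hS (basis H) (basis H)).tsum_eq, tsum_prod_comm]

/-- Swapping the factors swaps the two bases in the double sum, so cyclicity also gives independence
of the basis. -/
theorem hasSum_trace_mul (hS : IsHilbertSchmidt S) (hT : IsHilbertSchmidt T)
    (e : HilbertBasis ι ℂ H) :
    HasSum (fun i => ⟪e i, (S * T) (e i)⟫_ℂ) (trace (S * T)) := by
  rw [hS.trace_mul_comm hT, trace, (hT.hasSum_inner_mul hS (basis H) e).tsum_eq, tsum_prod_comm]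
  exact hS.hasSum_inner_mul hT e _

theorem trace_adjoint_mul_self (hT : IsHilbertSchmidt T) :
    trace (adjoint T * T) = hsNormSq T := by
  refine (hT.adjoint.hasSum_trace_mul hT (basis H)).unique ?_
  have h := Complex.ofRealCLM.hasSum (hT.hasSum (basis H))
  refine h.congr_fun fun i => ?_
  rw [mul_apply_eq_comp, adjoint_inner_right, inner_self_eq_norm_sq_to_K]
  simp

/-- The Cauchy-Schwarz inequality for the Hilbert-Schmidt inner product. -/
theorem norm_trace_mul_sq_le (hS : IsHilbertSchmidt S) (hT : IsHilbertSchmidt T) :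
    ‖trace (S * T)‖ ^ 2 ≤ hsNormSq S * hsNormSq T := by
  have h := (hS.hasSum_trace_mul hT (basis H))
  have hle : ∀ s : Finset (basisSet H), ‖∑ i ∈ s, ⟪basis H i, (S * T) (basis H i)⟫_ℂ‖ ^ 2 ≤
      hsNormSq S * hsNormSq T := fun s => by
    calc ‖∑ i ∈ s, ⟪basis H i, (S * T) (basis H i)⟫_ℂ‖ ^ 2
        ≤ (∑ i ∈ s, ‖adjoint S (basis H i)‖ * ‖T (basis H i)‖) ^ 2 := by
          refine pow_le_pow_left₀ (norm_nonneg _) (norm_sum_le_of_le _ fun i _ => ?_) 2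
          rw [mul_apply_eq_comp, ← adjoint_inner_left]
          exact norm_inner_le_norm _ _
      _ ≤ (∑ i ∈ s, ‖adjoint S (basis H i)‖ ^ 2) * ∑ i ∈ s, ‖T (basis H i)‖ ^ 2 :=
          Finset.sum_mul_sq_le_sq_mul_sq _ _ _
      _ ≤ hsNormSq S * hsNormSq T := by
          refine mul_le_mul ?_ ?_ (by positivity) (hsNormSq_nonneg _)
          · rw [← hS.hsNormSq_adjoint]
            exact sum_le_hasSum _ (fun _ _ => by positivity) (hS.adjoint.hasSum _)
          · exact sum_le_hasSum _ (fun _ _ => by positivity) (hT.hasSum _)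
  exact le_of_tendsto' (h.norm.pow 2) hle

end IsHilbertSchmidt

/-! ### Products of two Hilbert–Schmidt operators are trace-class. -/

theorem IsHilbertSchmidt.isTraceClass_mul {S T : H →L[ℂ] H} (hS : IsHilbertSchmidt S)
    (hT : IsHilbertSchmidt T) : IsTraceClass (S * T) := by
  set P := CFC.abs (S * T) with hP
  have hP0 : P.IsPositive := (nonneg_iff_isPositive P).1 (CFC.abs_nonneg _)
  refine ⟨_, basis H, ?_⟩
  have hre : ∀ i, ⟪basis H i, P (basis H i)⟫_ℂ =
      ((⟪basis H i, P (basis H i)⟫_ℂ).re : ℂ) := fun i =>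
    (Complex.eq_re_of_ofReal_le (r := 0) (by simpa using hP0.inner_nonneg_right (basis H i)))
  have h0 : ∀ i, 0 ≤ (⟪basis H i, P (basis H i)⟫_ℂ).re := fun i =>
    hP0.re_inner_nonneg_right (basis H i)
  suffices Summable fun i => (⟪basis H i, P (basis H i)⟫_ℂ).re by
    refine (Complex.ofRealCLM.summable this).congr fun i => (hre i).symm
  refine summable_of_sum_le (c := hsNormSq S + hsNormSq T) h0 fun s => ?_
  refine le_of_forall_pos_le_add fun δ hδ => ?_
  -- `V` may depend on the finite set `s`: the final bound does not involve it, and the errors over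
  -- `s` total at most `δ`.
  obtain ⟨V, hV, hVε⟩ := exists_norm_abs_sub_star_mul_le (S * T) (ε := δ / (s.card + 1))
    (div_pos hδ (Nat.cast_add_one_pos _))
  have hW : hsNormSq (adjoint V * S) ≤ hsNormSq S := by
    refine (hS.hsNormSq_mul_le _).trans (mul_le_of_le_one_left (hsNormSq_nonneg _) ?_)
    rw [← star_eq_adjoint, norm_star]
    exact pow_le_one₀ (norm_nonneg _) hV
  have hterm : ∀ i, (⟪basis H i, P (basis H i)⟫_ℂ).re ≤
      ‖adjoint (adjoint V * S) (basis H i)‖ ^ 2 + ‖T (basis H i)‖ ^ 2 + δ / (s.card + 1) := by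
    intro i
    have hn : ‖basis H i‖ = 1 := (basis H).orthonormal.1 i
    have e1 : ⟪basis H i, P (basis H i)⟫_ℂ =
        ⟪adjoint (adjoint V * S) (basis H i), T (basis H i)⟫_ℂ +
        ⟪basis H i, (P - star V * (S * T)) (basis H i)⟫_ℂ := by
      rw [adjoint_inner_left, ← inner_add_right]
      simp [star_eq_adjoint]
    have e2 : ‖⟪basis H i, (P - star V * (S * T)) (basis H i)⟫_ℂ‖ ≤ δ / (s.card + 1) := by
      refine (norm_inner_le_norm _ _).trans ?_
      rw [hn, one_mul]
      exact (le_of_opNorm_le _ hVε _).trans (by rw [hn, mul_one])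
    have e3 := norm_inner_le_norm (𝕜 := ℂ) (adjoint (adjoint V * S) (basis H i)) (T (basis H i))
    rw [e1, Complex.add_re]
    have e4 := Complex.re_le_norm ⟪adjoint (adjoint V * S) (basis H i), T (basis H i)⟫_ℂ
    have e5 := Complex.re_le_norm ⟪basis H i, (P - star V * (S * T)) (basis H i)⟫_ℂ
    nlinarith [sq_nonneg (‖adjoint (adjoint V * S) (basis H i)‖ - ‖T (basis H i)‖),
      sq_nonneg ‖adjoint (adjoint V * S) (basis H i)‖, sq_nonneg ‖T (basis H i)‖]
  refine (Finset.sum_le_sum fun i _ => hterm i).trans ?_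
  rw [Finset.sum_add_distrib, Finset.sum_add_distrib, Finset.sum_const, nsmul_eq_mul]
  have hVS := hS.mul_left (adjoint V)
  have a1 := sum_le_hasSum s (fun _ _ => by positivity) (hVS.adjoint.hasSum (basis H))
  have a2 := sum_le_hasSum s (fun _ _ => by positivity) (hT.hasSum (basis H))
  rw [hVS.hsNormSq_adjoint] at a1
  have a3 : (s.card : ℝ) * (δ / (s.card + 1)) ≤ δ := by
    rw [← mul_div_assoc, div_le_iff₀ (Nat.cast_add_one_pos _)]
    nlinarith
  linarith

theorem IsHilbertSchmidt.hasWellDefinedTrace_mul {S T : H →L[ℂ] H} (hS : IsHilbertSchmidt S)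
    (hT : IsHilbertSchmidt T) : HasWellDefinedTrace (S * T) :=
  ⟨hS.isTraceClass_mul hT, fun _ e => hS.hasSum_trace_mul hT e⟩

/-! ### Words in `T` and `T*`. -/

/-- The letter `T` or `T*`, according to a Boolean. -/
noncomputable def letter (T : H →L[ℂ] H) (b : Bool) : H →L[ℂ] H := if b then T else adjoint T

/-- The product of the letters `T` and `T*` that a list of Booleans spells. -/
noncomputable def word (T : H →L[ℂ] H) (L : List Bool) : H →L[ℂ] H := (L.map (letter T)).prod

/-- The list that spells the adjoint of a word. -/
def flip (L : List Bool) : List Bool := (L.map not).reverse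

theorem flip_append (K L : List Bool) : flip (K ++ L) = flip L ++ flip K := by
  simp [flip]

theorem length_flip (L : List Bool) : (flip L).length = L.length := by simp [flip]

/-- At the seam, the last letter of `flip L` is the negation of the first letter of `L`. -/
theorem isChain_flip_append {L : List Bool} (hL : L.IsChain (· ≠ ·)) :
    (flip L ++ L).IsChain (· ≠ ·) := by
  rw [List.isChain_append]
  refine ⟨?_, hL, ?_⟩
  · rw [flip, List.isChain_reverse, List.isChain_map]
    exact hL.imp fun a b h => by simpa using h.symm
  · cases L <;> simp [flip]

variable (T : H →L[ℂ] H)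

theorem word_append (K L : List Bool) : word T (K ++ L) = word T K * word T L := by
  simp [word]

theorem word_cons (b : Bool) (L : List Bool) : word T (b :: L) = letter T b * word T L := by
  simp [word]

theorem adjoint_letter (b : Bool) : adjoint (letter T b) = letter T (!b) := by
  cases b <;> simp [letter]

theorem adjoint_word (L : List Bool) : adjoint (word T L) = word T (flip L) := by
  induction L with
  | nil => simp [word, flip, ← star_eq_adjoint]
  | cons b L ih =>
    rw [word_cons, ← star_eq_adjoint, star_mul, star_eq_adjoint, star_eq_adjoint, ih,
      adjoint_letter, ← List.singleton_append, flip_append, word_append]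
    simp [word, flip]

theorem word_eq_pow (n : ℕ) : ∀ (a : Bool) (L : List Bool), (a :: L).IsChain (· ≠ ·) →
    L.length + 1 = 2 * n → word T (a :: L) = (letter T a * letter T (!a)) ^ n := by
  induction n with
  | zero => intro a L _ h; omega
  | succ n ih =>
    rintro a (_ | ⟨b, L⟩) hc hl
    · simp at hl; omega
    · rw [List.isChain_cons_cons] at hc
      obtain rfl : b = !a := by have := hc.1; revert this; cases a <;> cases b <;> simp
      rw [word_cons, word_cons, ← mul_assoc, pow_succ']
      congr 1
      rcases L with _ | ⟨c, L⟩
      · obtain rfl : n = 0 := by simp at hl; omega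
        simp [word]
      · have hc2 := hc.2
        rw [List.isChain_cons_cons] at hc2
        obtain rfl : c = a := by have := hc2.1; revert this; cases a <;> cases c <;> simp
        exact ih c L hc2.2 (by simp at hl; omega)

variable {T}

namespace IsHilbertSchmidt

theorem letter (hT : IsHilbertSchmidt T) (b : Bool) : IsHilbertSchmidt (letter T b) := by
  cases b
  · exact hT.adjoint
  · exact hT

theorem word (hT : IsHilbertSchmidt T) {L : List Bool} (hL : L ≠ []) :
    IsHilbertSchmidt (word T L) := by
  obtain ⟨b, L, rfl⟩ := List.exists_cons_of_ne_nil hL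
  rw [word_cons]
  exact (hT.letter b).mul_right _

protected theorem pow (hT : IsHilbertSchmidt T) {n : ℕ} (hn : n ≠ 0) :
    IsHilbertSchmidt (T ^ n) := by
  obtain ⟨n, rfl⟩ := Nat.exists_eq_succ_of_ne_zero hn
  rw [pow_succ]
  exact hT.mul_left _

theorem trace_word_append_comm (hT : IsHilbertSchmidt T) (K L : List Bool) :
    trace (TraceIneq.word T (K ++ L)) = trace (TraceIneq.word T (L ++ K)) := by
  rcases eq_or_ne K [] with rfl | hK
  · simp
  rcases eq_or_ne L [] with rfl | hL
  · simp
  rw [word_append, word_append, (hT.word hK).trace_mul_comm (hT.word hL)]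

theorem trace_word_flip_append (hT : IsHilbertSchmidt T) {L : List Bool} (hL : L ≠ []) :
    trace (TraceIneq.word T (flip L ++ L)) = hsNormSq (TraceIneq.word T L) := by
  rw [word_append, ← adjoint_word, (hT.word hL).trace_adjoint_mul_self]

theorem norm_trace_word_flip_append (hT : IsHilbertSchmidt T) {L : List Bool} (hL : L ≠ []) :
    ‖trace (TraceIneq.word T (flip L ++ L))‖ = hsNormSq (TraceIneq.word T L) := by
  rw [hT.trace_word_flip_append hL, Complex.norm_of_nonneg (hsNormSq_nonneg _)]

theorem norm_trace_word_append_sq_le (hT : IsHilbertSchmidt T) {K L : List Bool} (hK : K ≠ [])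
    (hL : L ≠ []) : ‖trace (TraceIneq.word T (K ++ L))‖ ^ 2 ≤
      ‖trace (TraceIneq.word T (flip K ++ K))‖ * ‖trace (TraceIneq.word T (flip L ++ L))‖ := by
  rw [hT.norm_trace_word_flip_append hK, hT.norm_trace_word_flip_append hL, word_append]
  exact (hT.word hK).norm_trace_mul_sq_le (hT.word hL)

end IsHilbertSchmidt

/-! ### Maximal words. -/

/-- A list of length `2 * n` whose word has the largest trace in absolute value among the words
of that length. -/
def IsMaxWord (T : H →L[ℂ] H) (n : ℕ) (L : List Bool) : Prop :=
  L.length = 2 * n ∧ ∀ K : List Bool, K.length = 2 * n → ‖trace (word T K)‖ ≤ ‖trace (word T L)‖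

theorem exists_isMaxWord (T : H →L[ℂ] H) (n : ℕ) : ∃ L, IsMaxWord T n L :=
  Set.exists_max_image {L : List Bool | L.length = 2 * n} (fun L => ‖trace (word T L)‖)
    (List.finite_length_eq Bool _) ⟨List.replicate (2 * n) true, by simp⟩

namespace IsMaxWord

variable {n k : ℕ} {K L : List Bool}

theorem of_norm_le (h : IsMaxWord T n L) (hK : K.length = 2 * n)
    (hle : ‖trace (word T L)‖ ≤ ‖trace (word T K)‖) : IsMaxWord T n K :=
  ⟨hK, fun K' h' => (h.2 K' h').trans hle⟩

/-- Reflecting the first half of a maximal word gives a maximal word. -/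
theorem flip_append (hT : IsHilbertSchmidt T) (hn : n ≠ 0) (h : IsMaxWord T n (K ++ L))
    (hK : K.length = n) : IsMaxWord T n (flip K ++ K) := by
  have hlen := h.1
  rw [List.length_append] at hlen
  have hKn : K ≠ [] := by rintro rfl; exact hn hK.symm
  have hLn : L ≠ [] := by rintro rfl; simp at hlen; omega
  refine h.of_norm_le (by rw [List.length_append, length_flip]; omega) ?_
  have h1 := hT.norm_trace_word_append_sq_le hKn hLn
  have h2 := h.2 (flip L ++ L) (by rw [List.length_append, length_flip]; omega)
  -- With `M` the maximum, `M² ≤ |Tr K*K| M`, which is impossible if `|Tr K*K| < M`.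
  by_contra! hlt
  have h3 := norm_nonneg (trace (word T (flip K ++ K)))
  nlinarith

theorem exists_isChain_take (hT : IsHilbertSchmidt T) (hn : n ≠ 0) (h : IsMaxWord T n L)
    (hk : k ≤ n) (hc : (L.take k).IsChain (· ≠ ·)) :
    ∃ K, IsMaxWord T n K ∧ (K.take (2 * k)).IsChain (· ≠ ·) := by
  have hl := h.1
  rw [← List.take_append_drop n L] at h
  have h1 := h.flip_append hT hn (by rw [List.length_take]; omega)
  set U := L.take k with hU
  set V := (L.take n).drop k with hV
  have hUV : L.take n = U ++ V := by
    rw [hU, hV, ← min_eq_left hk, ← List.take_take, min_eq_left hk, List.take_append_drop]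
  have hUk : U.length = k := by rw [hU, List.length_take]; omega
  rw [hUV, TraceIneq.flip_append, List.append_assoc] at h1
  refine ⟨(flip U ++ U) ++ (V ++ flip V), ?_, ?_⟩
  · refine h1.of_norm_le ?_ ?_
    · rw [← h1.1]; simp; omega
    · rw [hT.trace_word_append_comm]; simp
  · rw [List.take_left' (by rw [List.length_append, length_flip]; omega)]
    exact isChain_flip_append hc

theorem exists_isChain (hT : IsHilbertSchmidt T) (hn : n ≠ 0) :
    ∃ L, IsMaxWord T n L ∧ L.IsChain (· ≠ ·) := by
  -- One letter of each doubling is enough to reach a prefix of length `n`; a last doubling then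
  -- covers the whole word.
  have key : ∀ k, k + 1 ≤ n → ∃ L, IsMaxWord T n L ∧ (L.take (k + 1)).IsChain (· ≠ ·) := by
    intro k
    induction k with
    | zero =>
      intro _
      obtain ⟨L, hL⟩ := exists_isMaxWord T n
      refine ⟨L, hL, ?_⟩
      cases L <;> simp
    | succ k ih =>
      intro hk
      obtain ⟨L, hL, hc⟩ := ih (by omega)
      obtain ⟨K, hK, hc'⟩ := hL.exists_isChain_take hT hn (by omega) hc
      refine ⟨K, hK, ?_⟩
      have := hc'.take (k + 1 + 1)
      rwa [List.take_take, min_eq_left (by omega)] at this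
  obtain ⟨m, rfl⟩ := Nat.exists_eq_succ_of_ne_zero hn
  obtain ⟨L, hL, hc⟩ := key m le_rfl
  obtain ⟨K, hK, hc'⟩ := hL.exists_isChain_take hT hn le_rfl hc
  refine ⟨K, hK, ?_⟩
  rwa [List.take_of_length_le hK.1.le] at hc'

end IsMaxWord

/-! ### The trace inequality. -/

namespace IsHilbertSchmidt

theorem trace_letter_mul_pow (hT : IsHilbertSchmidt T) {n : ℕ} (hn : n ≠ 0) (a : Bool) :
    trace ((TraceIneq.letter T a * TraceIneq.letter T (!a)) ^ n) =
      trace ((adjoint T * T) ^ n) := by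
  cases a
  · rfl
  · obtain ⟨n, rfl⟩ := Nat.exists_eq_succ_of_ne_zero hn
    change trace ((T * adjoint T) ^ (n + 1)) = _
    rw [pow_succ', mul_assoc, hT.trace_mul_comm (hT.adjoint.mul_right _), mul_assoc, mul_pow_mul,
      ← mul_assoc, ← pow_succ']

/-- Among the words of length `2 * n` in `T` and `T*`, the alternating one has the largest
trace. -/
theorem norm_trace_word_le (hT : IsHilbertSchmidt T) {n : ℕ} (hn : n ≠ 0) {L : List Bool}
    (hL : L.length = 2 * n) :
    ‖trace (TraceIneq.word T L)‖ ≤ ‖trace ((adjoint T * T) ^ n)‖ := by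
  obtain ⟨K, hK, hc⟩ := IsMaxWord.exists_isChain hT hn
  refine (hK.2 L hL).trans_eq ?_
  rcases K with _ | ⟨a, K⟩
  · have := hK.1
    simp at this
    omega
  · rw [word_eq_pow T n a K hc hK.1, hT.trace_letter_mul_pow hn]

/-- The left side is the trace of `T*^n T^n`, a word of length `2n`. -/
theorem hsNormSq_pow_le (hT : IsHilbertSchmidt T) {n : ℕ} (hn : n ≠ 0) :
    hsNormSq (T ^ n) ≤ ‖trace ((adjoint T * T) ^ n)‖ := by
  have h : TraceIneq.word T (List.replicate n true) = T ^ n := by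
    simp [TraceIneq.word, TraceIneq.letter]
  rw [← h, ← hT.norm_trace_word_flip_append (by simpa using hn)]
  refine hT.norm_trace_word_le hn ?_
  rw [List.length_append, length_flip, List.length_replicate]
  omega

theorem norm_trace_mul_pow_le (hT : IsHilbertSchmidt T) {n : ℕ} (hn : n ≠ 0) (A : H →L[ℂ] H) :
    ‖trace (A * T ^ (2 * n))‖ ≤ ‖A‖ * hsNormSq (T ^ n) := by
  have hP := hT.pow hn
  rw [two_mul, pow_add, ← mul_assoc]
  refine le_of_sq_le_sq ?_ (mul_nonneg (norm_nonneg _) (hsNormSq_nonneg _))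
  calc ‖trace (A * T ^ n * T ^ n)‖ ^ 2 ≤ hsNormSq (A * T ^ n) * hsNormSq (T ^ n) :=
        (hP.mul_left A).norm_trace_mul_sq_le hP
    _ ≤ ‖A‖ ^ 2 * hsNormSq (T ^ n) * hsNormSq (T ^ n) :=
        mul_le_mul_of_nonneg_right (hP.hsNormSq_mul_le A) (hsNormSq_nonneg _)
    _ = (‖A‖ * hsNormSq (T ^ n)) ^ 2 := by ring

end IsHilbertSchmidt

open scoped ComplexOrder in
theorem HasWellDefinedTrace.trace_eq_norm {X : H →L[ℂ] H} (h : HasWellDefinedTrace X)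
    (hX : 0 ≤ X) : trace X = ‖trace X‖ :=
  Eq.symm <| RCLike.norm_of_nonneg' <| (h.2 _ (basis H)).nonneg fun _ => ((nonneg_iff_isPositive X).1 hX).inner_nonneg_right _

end TraceIneq

theorem lemma2 {H : Type u} [NormedAddCommGroup H] [InnerProductSpace ℂ H] [CompleteSpace H]
    (A T : H →L[ℂ] H) (hT : TraceIneq.IsHilbertSchmidt T) (N : ℕ) (hN : 1 ≤ N) :
    TraceIneq.HasWellDefinedTrace (A * T ^ (2 * N)) ∧
    TraceIneq.HasWellDefinedTrace ((ContinuousLinearMap.adjoint T * T) ^ N) ∧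
    (TraceIneq.trace ((ContinuousLinearMap.adjoint T * T) ^ N)).im = 0 ∧
    ‖TraceIneq.trace (A * T ^ (2 * N))‖ ≤
      ‖A‖ * (TraceIneq.trace ((ContinuousLinearMap.adjoint T * T) ^ N)).re := by
  have hN0 : N ≠ 0 := by omega
  have h1 : TraceIneq.HasWellDefinedTrace (A * T ^ (2 * N)) := by
    rw [two_mul, pow_add, ← mul_assoc]
    exact ((hT.pow hN0).mul_left A).hasWellDefinedTrace_mul (hT.pow hN0)
  have h2 : TraceIneq.HasWellDefinedTrace ((ContinuousLinearMap.adjoint T * T) ^ N) := by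
    obtain ⟨n, rfl⟩ := Nat.exists_eq_succ_of_ne_zero hN0
    rw [pow_succ', mul_assoc]
    exact hT.adjoint.hasWellDefinedTrace_mul (hT.mul_right _)
  have h3 := h2.trace_eq_norm (CStarAlgebra.pow_nonneg (star_mul_self_nonneg T) N)
  refine ⟨h1, h2, by rw [h3, Complex.ofReal_im], (hT.norm_trace_mul_pow_le hN0 A).trans ?_⟩
  rw [h3, Complex.ofReal_re]
  exact mul_le_mul_of_nonneg_left (hT.hsNormSq_pow_le hN0) (norm_nonneg _)
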